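/- Let $R$ be an associative unital $\mathbb C$-algebra (not necessarily commutative), let $G$ be a finite group acting on $R$ by $\mathbb C$-algebra automorphisms, and let $\alpha\colon G\times G\to R^{\times}$ be a two-cocycle with central image, that is, all $\alpha(\sigma,\tau)$ are central units of $R$ and $$(\rho\cdot\alpha(\sigma,\tau))\,\alpha(\rho,\sigma\tau)=\alpha(\rho,\sigma)\,\alpha(\rho\sigma,\tau)\qquad(\rho,\sigma,\tau\in G).$$ Let $A=R\#_\alpha G$ be the crossed product: $A=\bigoplus_{\sigma\in G}R\overline{\sigma}$ with multiplication $(p\overline{\sigma})(q\overline{\tau})=p\,(\sigma\cdot q)\,\alpha(\sigma,\tau)\,\overline{\sigma\tau}$. It is a $\mathbb C$-algebra with identity $\alpha(1,1)^{-1}\overline{1}$, it contains $R$ as the subalgebra $R\cdot 1_A$, and each $\overline\sigma$ is a unit of $A$ with $\overline{\sigma}p\,\overline{\sigma}^{-1}=\sigma\cdot p$ for $p\in R$. For a $\mathbb C$-algebra $B$ and a $B$-bimodule $M$ put $\mathrm{HH}^n(B,M)=\mathrm{Ext}^n_{B\otimes_{\mathbb C} B^{op}}(B,M)$ and $\mathrm{HH}^n(B)=\mathrm{HH}^n(B,B)$;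 regard $A$ as an $R$-bimodule by left and right multiplication. Then for every $n\ge 0$ the following holds. Transport of structure along the automorphisms $p\mapsto\sigma\cdot p$ of $R$ and the maps $a\mapsto\overline{\sigma}a\overline{\sigma}^{-1}$ of $A$ (on Hochschild cochains, $(\sigma\cdot f)(p_1\otimes\cdots\otimes p_n)=\overline{\sigma}f(\sigma^{-1}\cdot p_1\otimes\cdots\otimes\sigma^{-1}\cdot p_n)\overline{\sigma}^{-1}$) defines a $\mathbb C$-linear action of $G$ on $\mathrm{HH}^n(R,A)$, and there is an isomorphism of $\mathbb C$-vector spaces $$\mathrm{HH}^n(A)\cong\mathrm{HH}^n(R,A)^G$$ onto the subspace of $G$-invariant elements; it is induced by the restriction map $\mathrm{HH}^n(A)\to\mathrm{HH}^n(R,A)$ along the inclusion $R\to A$. -/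

import Mathlib

open scoped TensorProduct
open CategoryTheory

universe u

/-! ### Central two-cocycles and crossed products -/

/-- A two-cocycle `α : G × G → Rˣ` with central image, for a group `G` acting by automorphisms
on the ring `R`. No normalization is assumed. -/
structure CentralTwoCocycle (G R : Type u) [Group G] [Ring R] [MulSemiringAction G R] where
  /-- the underlying map -/
  toFun : G → G → Rˣ
  central : ∀ σ τ : G, (toFun σ τ : R) ∈ Subring.center R
  cocycle : ∀ ρ σ τ : G,
    (ρ • (toFun σ τ : R)) * (toFun ρ (σ * τ) : R) = (toFun ρ σ : R) * (toFun (ρ * σ) τ : R)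

namespace CentralTwoCocycle

variable {G R : Type u} [Group G] [Ring R] [MulSemiringAction G R]

instance : CoeFun (CentralTwoCocycle G R) (fun _ => G → G → Rˣ) := ⟨toFun⟩

variable (α : CentralTwoCocycle G R)

theorem comm (σ τ : G) (r : R) : r * (α σ τ : R) = (α σ τ : R) * r :=
  Subring.mem_center_iff.1 (α.central σ τ) r

theorem commInv (σ τ : G) (r : R) : r * (((α σ τ)⁻¹ : Rˣ) : R) = (((α σ τ)⁻¹ : Rˣ) : R) * r :=
  (Commute.units_inv_right (show Commute r (α σ τ : R) from α.comm σ τ r)).eq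

theorem one_left (τ : G) : α 1 τ = α 1 1 := by
  have h := α.cocycle 1 1 τ
  simp only [one_smul, one_mul] at h
  have h' : α 1 τ * α 1 τ = α 1 1 * α 1 τ := Units.ext (by simpa using h)
  exact mul_right_cancel h'

theorem smul_one_one (σ : G) : σ • (α 1 1 : R) = (α σ 1 : R) := by
  have h := α.cocycle σ 1 1
  simp only [mul_one] at h
  exact (Units.mul_left_inj _).1 h

theorem smul_inv (ρ σ τ : G) :
    (ρ • (((α σ τ)⁻¹ : Rˣ) : R)) * (ρ • (α σ τ : R)) = 1 := by
  rw [← smul_mul', Units.inv_mul, smul_one]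

theorem smul_inv_one_one (ρ : G) :
    (ρ • (((α 1 1)⁻¹ : Rˣ) : R)) * (α ρ 1 : R) = 1 := by
  rw [← α.smul_one_one, α.smul_inv]

end CentralTwoCocycle

/-- The multiplication of the crossed product on finitely supported functions `G → R`, that is, on
formal sums `∑_σ p_σ σ̄`: it is the biadditive extension of
`(p σ̄)(q τ̄) = p (σ · q) α(σ, τ) \overline{στ}`. -/
noncomputable def crossedMul {G R : Type u} [Group G] [Ring R] [MulSemiringAction G R]
    (α : CentralTwoCocycle G R) (x y : G →₀ R) : G →₀ R :=
  x.sum fun σ p => y.sum fun τ q => Finsupp.single (σ * τ) (p * (σ • q) * (α σ τ : R))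

section crossedMul

variable {G R : Type u} [Group G] [Ring R] [MulSemiringAction G R] (α : CentralTwoCocycle G R)

theorem crossedMul_single (σ τ : G) (p q : R) :
    crossedMul α (Finsupp.single σ p) (Finsupp.single τ q) =
      Finsupp.single (σ * τ) (p * (σ • q) * (α σ τ : R)) := by
  rw [crossedMul, Finsupp.sum_single_index, Finsupp.sum_single_index] <;> simp

theorem crossedMul_add (x y z : G →₀ R) :
    crossedMul α x (y + z) = crossedMul α x y + crossedMul α x z := by
  simp only [crossedMul, ← Finsupp.sum_add]
  refine Finsupp.sum_congr fun σ _ => ?_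
  rw [Finsupp.sum_add_index'] <;> simp [mul_add, add_mul]

theorem add_crossedMul (x y z : G →₀ R) :
    crossedMul α (x + y) z = crossedMul α x z + crossedMul α y z := by
  simp only [crossedMul]
  rw [Finsupp.sum_add_index'] <;> simp [add_mul]

theorem zero_crossedMul (x : G →₀ R) : crossedMul α 0 x = 0 := by simp [crossedMul]

theorem crossedMul_zero (x : G →₀ R) : crossedMul α x 0 = 0 := by simp [crossedMul]

theorem crossedMul_assoc (x y z : G →₀ R) :
    crossedMul α (crossedMul α x y) z = crossedMul α x (crossedMul α y z) := by
  induction x using Finsupp.induction_linear with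
  | zero => simp [zero_crossedMul]
  | add x x' hx hx' => simp only [add_crossedMul, hx, hx']
  | single ρ p =>
    induction y using Finsupp.induction_linear with
    | zero => simp [zero_crossedMul, crossedMul_zero]
    | add y y' hy hy' => simp only [crossedMul_add, add_crossedMul, hy, hy']
    | single σ q =>
      induction z using Finsupp.induction_linear with
      | zero => simp [crossedMul_zero]
      | add z z' hz hz' => simp only [crossedMul_add, hz, hz']
      | single τ r =>
        simp only [crossedMul_single, mul_assoc, smul_mul', mul_smul]
        congr 1
        have h := α.cocycle ρ σ τ
        rw [h, ← mul_assoc (α ρ σ : R) (ρ • σ • r), ← α.comm ρ σ (ρ • σ • r), mul_assoc]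

theorem one_crossedMul (x : G →₀ R) :
    crossedMul α (Finsupp.single 1 (((α 1 1)⁻¹ : Rˣ) : R)) x = x := by
  induction x using Finsupp.induction_linear with
  | zero => simp [crossedMul_zero]
  | add x x' hx hx' => simp only [crossedMul_add, hx, hx']
  | single σ p =>
    rw [crossedMul_single, α.one_left σ, ← α.commInv, one_mul, one_smul, mul_assoc,
      Units.inv_mul, mul_one]

theorem crossedMul_one (x : G →₀ R) :
    crossedMul α x (Finsupp.single 1 (((α 1 1)⁻¹ : Rˣ) : R)) = x := by
  induction x using Finsupp.induction_linear with
  | zero => simp [zero_crossedMul]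
  | add x x' hx hx' => simp only [add_crossedMul, hx, hx']
  | single σ p =>
    rw [crossedMul_single, mul_assoc, α.smul_inv_one_one, mul_one, mul_one]

variable [Algebra ℂ R]

theorem smul_crossedMul (c : ℂ) (x y : G →₀ R) :
    crossedMul α (c • x) y = c • crossedMul α x y := by
  induction x using Finsupp.induction_linear with
  | zero => simp [zero_crossedMul]
  | add x x' hx hx' => simp only [smul_add, add_crossedMul, hx, hx']
  | single σ p =>
    induction y using Finsupp.induction_linear with
    | zero => simp [crossedMul_zero]
    | add y y' hy hy' => simp only [smul_add, crossedMul_add, hy, hy']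
    | single τ q => simp only [crossedMul_single, Finsupp.smul_single, smul_mul_assoc]

theorem crossedMul_smul [SMulCommClass G ℂ R] (c : ℂ) (x y : G →₀ R) :
    crossedMul α x (c • y) = c • crossedMul α x y := by
  induction x using Finsupp.induction_linear with
  | zero => simp [zero_crossedMul]
  | add x x' hx hx' => simp only [smul_add, add_crossedMul, hx, hx']
  | single σ p =>
    induction y using Finsupp.induction_linear with
    | zero => simp [crossedMul_zero]
    | add y y' hy hy' => simp only [smul_add, crossedMul_add, hy, hy']
    | single τ q =>
      simp only [crossedMul_single, Finsupp.smul_single, smul_comm σ c q, mul_smul_comm,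
        smul_mul_assoc]

end crossedMul

/-- The crossed product `A = R #_α G`: as an abelian group it is `⨁_{σ ∈ G} R σ̄`, that is, the
finitely supported functions `G → R`. -/
def CrossedProduct {G R : Type u} [Group G] [Ring R] [MulSemiringAction G R]
    (_α : CentralTwoCocycle G R) : Type u := G →₀ R

namespace CrossedProduct

variable {G R : Type u} [Group G] [Ring R] [MulSemiringAction G R] (α : CentralTwoCocycle G R)

noncomputable instance : AddCommGroup (CrossedProduct α) :=
  inferInstanceAs (AddCommGroup (G →₀ R))

noncomputable instance : Ring (CrossedProduct α) :=
  { (inferInstance : AddCommGroup (CrossedProduct α)) with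
    mul := crossedMul α
    one := Finsupp.single 1 (((α 1 1)⁻¹ : Rˣ) : R)
    mul_assoc := crossedMul_assoc α
    one_mul := one_crossedMul α
    mul_one := crossedMul_one α
    left_distrib := crossedMul_add α
    right_distrib := add_crossedMul α
    zero_mul := zero_crossedMul α
    mul_zero := crossedMul_zero α }

/-- The element `p σ̄ = p ⊗ σ` of the crossed product. -/
noncomputable def single (σ : G) (p : R) : CrossedProduct α := (Finsupp.single σ p : G →₀ R)

theorem single_mul_single (σ τ : G) (p q : R) :
    single α σ p * single α τ q = single α (σ * τ) (p * (σ • q) * (α σ τ : R)) :=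
  crossedMul_single α σ τ p q

theorem one_def : (1 : CrossedProduct α) = single α 1 (((α 1 1)⁻¹ : Rˣ) : R) := rfl

/-- The unit `σ̄ = 1 ⊗ σ` of the crossed product. -/
noncomputable def bar (σ : G) : (CrossedProduct α)ˣ where
  val := single α σ 1
  inv := single α σ⁻¹ ((((α 1 1)⁻¹ : Rˣ) : R) * (((α σ⁻¹ σ)⁻¹ : Rˣ) : R))
  val_inv := by
    rw [single_mul_single, one_def, mul_inv_cancel, one_mul, smul_mul']
    congr 1
    have h := α.cocycle σ σ⁻¹ σ
    rw [inv_mul_cancel, mul_inv_cancel, α.one_left σ] at h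
    have h1 := α.smul_inv_one_one σ
    have h2 := α.smul_inv σ σ⁻¹ σ
    apply Units.eq_inv_of_mul_eq_one_right
    rw [mul_assoc, mul_assoc, ← h, ← mul_assoc (σ • (((α σ⁻¹ σ)⁻¹ : Rˣ) : R)), h2, one_mul, h1]
  inv_val := by
    rw [single_mul_single, one_def, inv_mul_cancel, smul_one, mul_one, mul_assoc, Units.inv_mul,
      mul_one]

section algebra

variable [Algebra ℂ R] [SMulCommClass G ℂ R]

noncomputable instance : Module ℂ (CrossedProduct α) := inferInstanceAs (Module ℂ (G →₀ R))

noncomputable instance : Algebra ℂ (CrossedProduct α) :=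
  Algebra.ofModule (smul_crossedMul α) (crossedMul_smul α)

/-- The inclusion of `R` as a subalgebra of `R #_α G`, sending `p` to `p · 1`, where
`1 = α(1, 1)⁻¹ 1̄` (so `p ↦ p ⊗ 1` if `α` is normalized). -/
noncomputable def incl : R →ₐ[ℂ] CrossedProduct α where
  toFun p := single α 1 (p * (((α 1 1)⁻¹ : Rˣ) : R))
  map_one' := by rw [one_mul, one_def]
  map_mul' p q := by
    rw [single_mul_single, one_mul, one_smul, mul_assoc _ (q * _), mul_assoc q, Units.inv_mul,
      mul_one, mul_assoc p, mul_assoc p, ← α.commInv]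
  map_zero' := by rw [zero_mul]; exact Finsupp.single_zero (M := R) (1 : G)
  map_add' p q := by rw [add_mul]; exact Finsupp.single_add (M := R) (1 : G) _ _
  commutes' c := by
    rw [Algebra.algebraMap_eq_smul_one, Algebra.algebraMap_eq_smul_one, one_def, smul_mul_assoc,
      one_mul]
    exact (Finsupp.smul_single c _ _).symm

theorem incl_mul_single (p q : R) (σ : G) : incl α p * single α σ q = single α σ (p * q) := by
  change single α 1 _ * _ = _
  rw [single_mul_single, α.one_left σ, one_mul, one_smul, mul_assoc, α.comm, ← mul_assoc,
    mul_assoc p, Units.inv_mul, mul_one]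

/-- The action of `G` on `R` becomes inner on the crossed product: `σ̄ p = (σ · p) σ̄`. -/
theorem bar_mul_incl (σ : G) (p : R) :
    (bar α σ : CrossedProduct α) * incl α p = incl α (σ • p) * (bar α σ : CrossedProduct α) := by
  change single α σ 1 * single α 1 _ = _ * single α σ 1
  rw [incl_mul_single, single_mul_single, mul_one, one_mul, mul_one, smul_mul', mul_assoc,
    α.smul_inv_one_one, mul_one]

end algebra

end CrossedProduct

/-! ### Hochschild cohomology -/

namespace Hochschild

/-- The enveloping algebra `B^e = B ⊗ B^op` of a `ℂ`-algebra `B`. -/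
abbrev Env (B : Type u) [Ring B] [Algebra ℂ B] : Type u := B ⊗[ℂ] Bᵐᵒᵖ

/-- `B` as a bimodule over itself: the `B^e`-module `B` with `(a ⊗ b) · x = a x b`. -/
noncomputable def regular (B : Type u) [Ring B] [Algebra ℂ B] : ModuleCat.{u} (Env B) :=
  letI : Module (Env B) B := instModuleTensorProductMop ℂ B
  ModuleCat.of (Env B) B

/-- The Hochschild cohomology `HH^n(B, M) = Ext^n_{B^e}(B, M)` of a `ℂ`-algebra `B` with
coefficients in a `B`-bimodule `M`; it is a `ℂ`-vector space. -/
abbrev HH (B : Type u) [Ring B] [Algebra ℂ B] (M : ModuleCat.{u} (Env B)) (n : ℕ) : Type u :=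
  Abelian.Ext.{u} (regular B) M n

section

variable {B C : Type u} [Ring B] [Algebra ℂ B] [Ring C] [Algebra ℂ C]

/-- The map `f ⊗ f^op : B^e → C^e` induced by an algebra map `f : B → C`. -/
noncomputable abbrev envMap (f : B →ₐ[ℂ] C) : Env B →ₐ[ℂ] Env C :=
  Algebra.TensorProduct.map f (AlgHom.op f)

/-- Restriction of bimodules along an algebra map `f : B → C`. -/
noncomputable abbrev restrict (f : B →ₐ[ℂ] C) : ModuleCat.{u} (Env C) ⥤ ModuleCat.{u} (Env B) :=
  ModuleCat.restrictScalars (envMap f).toRingHom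

theorem restrict_exact (f : B →ₐ[ℂ] C) (S : ShortComplex (ModuleCat.{u} (Env C)))
    (h : S.Exact) : (S.map (restrict f)).Exact := by
  rw [ShortComplex.ShortExact.moduleCat_exact_iff_function_exact] at h ⊢
  exact h

instance (f : B →ₐ[ℂ] C) : Limits.PreservesFiniteLimits (restrict f) := by
  have := ((Functor.exact_tfae (restrict f)).out 1 3).mp (restrict_exact f)
  exact this.1

instance (f : B →ₐ[ℂ] C) : Limits.PreservesFiniteColimits (restrict f) := by
  have := ((Functor.exact_tfae (restrict f)).out 1 3).mp (restrict_exact f)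
  exact this.2

theorem regular_smul (b : B) (b' : Bᵐᵒᵖ) (x : B) :
    ((b ⊗ₜ[ℂ] b' : Env B) • (show regular B from x) : regular B) = b * x * b'.unop :=
  AlgHom.mulLeftRight_apply ℂ B b b' x

/-- To define a morphism of `B`-bimodules it suffices to give an additive map compatible with
the actions of pure tensors. -/
noncomputable def homMk {M N : ModuleCat.{u} (Env B)} (g : M →+ N)
    (h : ∀ (b : B) (b' : Bᵐᵒᵖ) (x : M), g ((b ⊗ₜ[ℂ] b' : Env B) • x) = (b ⊗ₜ[ℂ] b' : Env B) • g x) :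
    M ⟶ N :=
  ModuleCat.ofHom
    { toFun := g
      map_add' := g.map_add
      map_smul' := fun t x => by
        change g (t • x) = t • g x
        induction t using TensorProduct.induction_on with
        | zero => 
          exact (congrArg g (zero_smul (Env B) x)).trans
            (g.map_zero.trans (zero_smul (Env B) (g x)).symm)
        | tmul b b' => exact h b b' x
        | add s t hs ht => rw [add_smul, add_smul, map_add, hs, ht] }

/-- An algebra map `f : B → C`, viewed as a morphism of `B`-bimodules. -/
noncomputable def regularMap (f : B →ₐ[ℂ] C) : regular B ⟶ (restrict f).obj (regular C) :=
  homMk (M := regular B) (N := (restrict f).obj (regular C)) (f : B →+ C) fun b b' x => by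
    rw [ModuleCat.restrictScalars.smul_def]
    refine (congrArg f (regular_smul b b' x)).trans (Eq.trans ?_
      (regular_smul (f b) (AlgHom.op f b') (f x)).symm)
    exact (map_mul f (b * _) _).trans (congrArg (· * _) (map_mul f b _))

end

end Hochschild

namespace CrossedProduct

open Hochschild

variable {G R : Type u} [Group G] [Ring R] [Algebra ℂ R] [MulSemiringAction G R]
  [SMulCommClass G ℂ R] (α : CentralTwoCocycle G R)

/-- The crossed product `A = R #_α G` as an `R`-bimodule under left and right multiplication. -/
noncomputable def coeff : ModuleCat.{u} (Env R) :=
  (restrict (incl α)).obj (regular (CrossedProduct α))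

theorem coeff_smul (b : R) (b' : Rᵐᵒᵖ) (x : CrossedProduct α) :
    ((b ⊗ₜ[ℂ] b' : Env R) • (show coeff α from x) : coeff α) =
      incl α b * x * incl α b'.unop :=
  regular_smul (incl α b) (AlgHom.op (incl α) b') x

/-- The automorphism `p ↦ σ⁻¹ · p` of the algebra `R`. -/
noncomputable def invAut (R : Type u) [Ring R] [Algebra ℂ R] [MulSemiringAction G R]
    [SMulCommClass G ℂ R] (σ : G) : R →ₐ[ℂ] R := MulSemiringAction.toAlgHom ℂ R σ⁻¹

theorem bar_conj (σ : G) (p q : R) (x : CrossedProduct α) :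
    (bar α σ : CrossedProduct α) * (incl α (σ⁻¹ • p) * x * incl α (σ⁻¹ • q)) *
        (((bar α σ)⁻¹ : (CrossedProduct α)ˣ) : CrossedProduct α) =
      incl α p * ((bar α σ : CrossedProduct α) * x *
        (((bar α σ)⁻¹ : (CrossedProduct α)ˣ) : CrossedProduct α)) * incl α q := by
  have h (p : R) : (bar α σ : CrossedProduct α) * incl α (σ⁻¹ • p) =
      incl α p * (bar α σ : CrossedProduct α) := by
    rw [bar_mul_incl, smul_inv_smul]
  have h' : incl α (σ⁻¹ • q) * (((bar α σ)⁻¹ : (CrossedProduct α)ˣ) : CrossedProduct α) =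
      (((bar α σ)⁻¹ : (CrossedProduct α)ˣ) : CrossedProduct α) * incl α q := by
    rw [Units.mul_inv_eq_iff_eq_mul, mul_assoc, ← h, Units.inv_mul_cancel_left]
  simp only [mul_assoc, h']
  rw [← mul_assoc, h, mul_assoc]

/-- The map `a ↦ σ̄ a σ̄⁻¹`, as a morphism of `R`-bimodules from `A`, with its bimodule structure
twisted by the automorphism `p ↦ σ⁻¹ · p` of `R`, to `A`. -/
noncomputable def conjBar (σ : G) : (restrict (invAut R σ)).obj (coeff α) ⟶ coeff α :=
  homMk (M := (restrict (invAut R σ)).obj (coeff α)) (N := coeff α)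
    ((AddMonoidHom.mulRight (((bar α σ)⁻¹ : (CrossedProduct α)ˣ) : CrossedProduct α)).comp
      (AddMonoidHom.mulLeft (bar α σ : CrossedProduct α)))
    fun b b' x =>
      (congrArg (fun y : CrossedProduct α => (bar α σ : CrossedProduct α) * y *
          (((bar α σ)⁻¹ : (CrossedProduct α)ˣ) : CrossedProduct α))
        (coeff_smul α (σ⁻¹ • b) (AlgHom.op (invAut R σ) b') x)).trans
      ((bar_conj α σ b b'.unop x).trans (coeff_smul α b b' _).symm)

/-- The action of `σ ∈ G` on `HH^n(R, A)`, by transport of structure along the automorphism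
`p ↦ σ · p` of `R` and the map `a ↦ σ̄ a σ̄⁻¹` of `A`: a class `x ∈ Ext^n_{R^e}(R, A)` is first
regarded as an extension class of bimodules twisted by `σ⁻¹`, then composed with `p ↦ σ⁻¹ · p`
on the side of `R` and with `a ↦ σ̄ a σ̄⁻¹` on the side of `A`. On Hochschild cochains this is
`(σ · f)(p₁ ⊗ ⋯ ⊗ pₙ) = σ̄ f(σ⁻¹ · p₁ ⊗ ⋯ ⊗ σ⁻¹ · pₙ) σ̄⁻¹`. -/
noncomputable def conjHH (σ : G) (n : ℕ) (x : HH R (coeff α) n) : HH R (coeff α) n :=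
  ((Abelian.Ext.mk₀ (regularMap (invAut R σ))).comp
    (x.mapExactFunctor (restrict (invAut R σ))) (zero_add n)).comp
      (Abelian.Ext.mk₀ (conjBar α σ)) (add_zero n)

/-- The restriction map `HH^n(A, A) → HH^n(R, A)`: restrict an extension class of `A`-bimodules to
one of `R`-bimodules, and compose with the inclusion `R → A`. On Hochschild cochains it restricts
a multilinear map `A × ⋯ × A → A` to `R × ⋯ × R`. -/
noncomputable def resHH (n : ℕ) (x : HH (CrossedProduct α) (regular (CrossedProduct α)) n) :
    HH R (coeff α) n :=
  (Abelian.Ext.mk₀ (regularMap (incl α))).comp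
    (x.mapExactFunctor (restrict (incl α))) (zero_add n)

end CrossedProduct

/-!
Write `A = R #_α G`. The statement is proved for every `A`-bimodule `M` in place of the coefficients
`A`: restriction `HH^n(A, M) → HH^n(R, M)` is injective, with image the elements fixed by the
operators of `G` (`CrossedProduct.resExt`, `CrossedProduct.conjExt`). The proof is by dimension
shifting in `M`.

In degree zero, `HH^0(R, M)` consists of the elements of `M` commuting with `R`, and `σ` acts on it
by `m ↦ σ̄ m σ̄⁻¹`; since `A` is generated by `R` and the units `σ̄`, the invariants are the
elements commuting with `A`, which is `HH^0(A, M)`. The elements `σ̄` multiply only up to values of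
`α`, but these are central units of `R`, and conjugation by them is trivial on `HH^0(R, M)`.

For the induction, `M` embeds into `I = Hom_ℂ(A ⊗ A^op, M)`, which is injective as an `A`-bimodule
and also as an `R`-bimodule, because `A ⊗ A^op` is free of finite rank over `R ⊗ R^op`, with basis
`σ̄ ⊗ τ̄` (`CrossedProduct.exists_mono_injective`). With `N = I / M`, the group `HH^{n+1}(-, M)` is
the cokernel of `HH^n(-, I) → HH^n(-, N)`, both over `A` and over `R`. The restriction maps and the
operators of `G` are compatible with the connecting maps, by naturality of extension classes
(`CrossedProduct.resExt_comp_extClass`, `CrossedProduct.conjExt_comp_extClass`). Hence the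
identities saying that `G` acts, and that restricted classes are invariant, propagate from degree
zero; and so does the isomorphism, because averaging over `G` makes invariants exact
(`Representation.exists_mem_invariants_of_map_mem_invariants`).
-/

/-! ### The crossed product as a module over `R` -/

namespace CrossedProduct
section
variable {G R : Type u} [Group G] [Ring R] [MulSemiringAction G R] (α : CentralTwoCocycle G R)

@[elab_as_elim]
theorem induction_single {P : CrossedProduct α → Prop} (zero : P 0)
    (add : ∀ x y, P x → P y → P (x + y)) (single : ∀ σ p, P (single α σ p))
    (x : CrossedProduct α) : P x :=
  Finsupp.induction_linear (M := R) x zero add single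

variable [Algebra ℂ R]

/-- The coefficient of the identity of `A = R #_α G`: the projection of `A` onto the summand `R` of
the decomposition `A = ⨁ R σ̄`. Since `1 = α(1, 1)⁻¹ 1̄`, the summand `R 1̄` is identified with `R`
by `p 1̄ ↦ p α(1, 1)`. -/
noncomputable def proj : CrossedProduct α →ₗ[ℂ] R :=
  (LinearMap.mulRight ℂ (α 1 1 : R)).comp (Finsupp.lapply (M := R) (R := ℂ) (1 : G))

theorem proj_single (σ : G) (p : R) [Decidable (σ = 1)] :
    proj α (single α σ p) = if σ = 1 then p * (α 1 1 : R) else 0 := by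
  classical
  change (Finsupp.single σ p : G →₀ R) 1 * _ = _
  rw [Finsupp.single_apply]
  split_ifs <;> simp

variable [SMulCommClass G ℂ R]

theorem single_eq_incl_mul_bar (σ : G) (p : R) :
    single α σ p = incl α p * (bar α σ : CrossedProduct α) := by
  change _ = _ * single α σ 1
  rw [incl_mul_single, mul_one]

theorem single_eq_bar_mul_incl (σ : G) (p : R) :
    single α σ p = (bar α σ : CrossedProduct α) * incl α (σ⁻¹ • p) := by
  rw [bar_mul_incl, smul_inv_smul, single_eq_incl_mul_bar]

theorem proj_incl (p : R) : proj α (incl α p) = p := by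
  classical
  change proj α (single α 1 (p * _)) = p
  rw [proj_single, if_pos rfl, mul_assoc, Units.inv_mul, mul_one]

theorem proj_incl_mul (r : R) (x : CrossedProduct α) :
    proj α (incl α r * x) = r * proj α x := by
  classical
  induction x using induction_single with
  | zero => simp
  | add x y hx hy => simp [mul_add, hx, hy]
  | single σ p =>
    rw [incl_mul_single, proj_single, proj_single]
    split_ifs <;> simp [mul_assoc]

theorem proj_mul_incl (x : CrossedProduct α) (r : R) :
    proj α (x * incl α r) = proj α x * r := by
  classical
  induction x using induction_single with
  | zero => simp
  | add x y hx hy => simp [add_mul, hx, hy]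
  | single σ p =>
    rw [single_eq_incl_mul_bar, mul_assoc, bar_mul_incl, ← mul_assoc, ← map_mul,
      ← single_eq_incl_mul_bar, ← single_eq_incl_mul_bar, proj_single, proj_single]
    split_ifs with h
    · subst h
      rw [one_smul, mul_assoc, mul_assoc, α.comm]
    · simp

theorem bar_mul_bar (σ τ : G) :
    (bar α σ * bar α τ : CrossedProduct α) = incl α (α σ τ : R) * bar α (σ * τ) := by
  rw [← single_eq_incl_mul_bar]
  change single α σ 1 * single α τ 1 = _
  rw [single_mul_single, smul_one, one_mul, one_mul]

theorem proj_inv_bar_mul_bar [DecidableEq G] (σ τ : G) :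
    proj α (((bar α σ)⁻¹ : (CrossedProduct α)ˣ) * (bar α τ : CrossedProduct α)) =
      if τ = σ then 1 else 0 := by
  split_ifs with h
  · subst h
    rw [Units.inv_mul, ← map_one (incl α), proj_incl]
  · change proj α (single α σ⁻¹ _ * single α τ 1) = 0
    rw [single_mul_single, proj_single, if_neg]
    rwa [inv_mul_eq_one, eq_comm]

theorem proj_bar_mul_inv_bar [DecidableEq G] (σ τ : G) :
    proj α ((bar α τ : CrossedProduct α) * ((bar α σ)⁻¹ : (CrossedProduct α)ˣ)) =
      if τ = σ then 1 else 0 := by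
  split_ifs with h
  · subst h
    rw [Units.mul_inv, ← map_one (incl α), proj_incl]
  · change proj α (single α τ 1 * single α σ⁻¹ _) = 0
    rw [single_mul_single, proj_single, if_neg]
    rwa [mul_inv_eq_one]

variable [Fintype G]

/-- The units `σ̄`, with the maps `x ↦ proj (σ̄⁻¹ x)`, form a dual basis of `A` as a right
`R`-module. -/
theorem sum_bar_mul_proj (x : CrossedProduct α) :
    ∑ σ : G, (bar α σ : CrossedProduct α) *
      incl α (proj α (((bar α σ)⁻¹ : (CrossedProduct α)ˣ) * x)) = x := by
  classical
  induction x using induction_single with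
  | zero => simp
  | add x y hx hy => simp [mul_add, Finset.sum_add_distrib, hx, hy]
  | single τ p =>
    simp only [single_eq_bar_mul_incl, ← mul_assoc, proj_mul_incl, proj_inv_bar_mul_bar]
    simp [apply_ite (incl α)]

/-- The units `σ̄`, with the maps `x ↦ proj (x σ̄⁻¹)`, form a dual basis of `A` as a left
`R`-module. -/
theorem sum_proj_mul_bar (x : CrossedProduct α) :
    ∑ σ : G, incl α (proj α (x * ((bar α σ)⁻¹ : (CrossedProduct α)ˣ))) *
      (bar α σ : CrossedProduct α) = x := by
  classical
  induction x using induction_single with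
  | zero => simp
  | add x y hx hy => simp [add_mul, Finset.sum_add_distrib, hx, hy]
  | single τ p =>
    simp only [single_eq_incl_mul_bar, mul_assoc, proj_incl_mul, proj_bar_mul_inv_bar]
    simp [apply_ite (incl α)]

end
end CrossedProduct

/-! ### Bimodules injective over both algebras -/

open scoped ModuleCat in
/-- If `T` has a finite dual basis `(u i, p i)` as a right module over `S`, then every `T`-module
coinduced from `ℂ` restricts to an injective `S`-module: an `S`-linear map `g : X → Hom_ℂ(T, V)` is
determined by the linear maps `x ↦ g x (u i)` through `g x a = ∑ i, g (p i a • x) (u i)`, and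
linear maps extend along `X ↪ Y` because `ℂ` is a field. -/
theorem injective_restrictScalars_coextendScalars {S T : Type u} [Ring S] [Ring T] [Algebra ℂ S]
    [Algebra ℂ T] (φ : S →ₐ[ℂ] T) {ι : Type*} [Fintype ι] (u : ι → T) (p : ι → T →ₗ[ℂ] S)
    (hp : ∀ i a s, p i (a * φ s) = p i a * s) (hu : ∀ a, ∑ i, u i * φ (p i a) = a)
    (V : ModuleCat.{u} ℂ) :
    Injective ((ModuleCat.restrictScalars φ.toRingHom).obj
      ((ModuleCat.coextendScalars (algebraMap ℂ T)).obj V)) where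
  factors {X Y} g f hf := by
    let e := ModuleCat.CoextendScalars.equiv (algebraMap ℂ T) V
    have hinj : Function.Injective f.hom := (ModuleCat.mono_iff_injective f).1 hf
    have hg (s : S) (x : X) (a : T) : e (g.hom (s • x)) a = e (g.hom x) (a * φ s) := by
      rw [map_smul]
      exact ModuleCat.CoextendScalars.smul_apply _ _ _ _ _
    have hgc (c : ℂ) (x : X) (a : T) : e (g.hom (c • x)) a = c • e (g.hom x) a := by
      rw [← algebraMap_smul S c x, hg, AlgHom.commutes, ← Algebra.commutes]
      exact (e (g.hom x)).map_smul c a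
    -- the components `g_i : X → V` of `g`
    let gl (i : ι) : X →ₗ[ℂ] V :=
      { toFun x := e (g.hom x) (u i)
        map_add' x y := by
          rw [map_add]
          exact congrArg (fun h => h (u i)) (map_add e (g.hom x) (g.hom y))
        map_smul' c x := hgc c x (u i) }
    let fl : X →ₗ[ℂ] Y := f.hom.restrictScalars ℂ
    -- the extension of `g_i` to `Y` is `g_i ∘ r`, for a `ℂ`-linear retraction `r` of `f`
    obtain ⟨r, hr⟩ := fl.exists_leftInverse_of_injective (LinearMap.ker_eq_bot.2 hinj)
    have hr' (x : X) : r (f.hom x) = x := congrArg (fun h => h x) hr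
    let h0 (y : Y) : (ModuleCat.restrictScalars (algebraMap ℂ T)).obj (ModuleCat.of T T) →ₗ[ℂ] V :=
      { toFun a := ∑ i, gl i (r (p i (show T from a) • y))
        map_add' a b := by
          rw [← Finset.sum_add_distrib]
          refine Finset.sum_congr rfl fun i _ => ?_
          rw [← map_add, ← map_add, ← add_smul]
          exact congrArg (fun t => gl i (r (t • y))) (map_add (p i) (show T from a) (show T from b))
        map_smul' c a := by
          rw [RingHom.id_apply, Finset.smul_sum]
          refine Finset.sum_congr rfl fun i _ => ?_
          rw [← map_smul, ← map_smul, ← smul_assoc, ← map_smul, Algebra.smul_def]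
          rfl }
    refine ⟨ModuleCat.ofHom (Y := (ModuleCat.restrictScalars φ.toRingHom).obj
      ((ModuleCat.coextendScalars (algebraMap ℂ T)).obj V))
      { toFun y := e.symm (h0 y)
        map_add' y z := ?_
        map_smul' s y := ?_ }, ?_⟩
    · refine (congrArg e.symm ?_).trans (map_add e.symm (h0 y) (h0 z))
      refine LinearMap.ext fun a => ?_
      change ∑ i, gl i (r (p i (show T from a) • (y + z))) =
        ∑ i, gl i (r (p i (show T from a) • y)) + ∑ i, gl i (r (p i (show T from a) • z))
      rw [← Finset.sum_add_distrib]
      exact Finset.sum_congr rfl fun i _ => by rw [smul_add, map_add, map_add]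
    · refine e.injective (LinearMap.ext fun a => ?_)
      refine Eq.trans ?_ (ModuleCat.CoextendScalars.smul_apply _ _ (e.symm (h0 y)) (φ s) a).symm
      refine Finset.sum_congr rfl fun i _ => congrArg (fun y => gl i (r y)) ?_
      exact (mul_smul _ s y).symm.trans (congrArg (· • y) (hp i a s).symm)
    · ext x
      refine e.injective (LinearMap.ext fun (a : T) => ?_)
      refine Eq.trans (Finset.sum_congr rfl fun i _ => ?_ :
        _ = ∑ i, e (g.hom x) (u i * φ (p i a))) ?_
      · rw [← hg]
        exact congrArg (fun x => e (g.hom x) (u i))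
          ((congrArg r (map_smul f.hom (p i a) x).symm).trans (hr' (p i a • x)))
      exact (map_sum (e (g.hom x)) (fun i => u i * φ (p i a)) _).symm.trans
        (congrArg _ (hu a))

theorem injective_coextendScalars_complex {T : Type u} [Ring T] [Algebra ℂ T]
    (V : ModuleCat.{u} ℂ) :
    Injective ((ModuleCat.coextendScalars (algebraMap ℂ T)).obj V) := by
  have := (Module.injective_iff_injective_object ℂ V).1 (Module.injective_of_isSemisimpleRing ℂ V)
  exact (ModuleCat.restrictCoextendScalarsAdj (algebraMap ℂ T)).map_injective V this

namespace CrossedProduct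

open Hochschild

variable {G R : Type u} [Group G] [Ring R] [MulSemiringAction G R] (α : CentralTwoCocycle G R)
  [Algebra ℂ R] [SMulCommClass G ℂ R]

/-- The map `a ⊗ b ↦ proj (σ̄⁻¹ a) ⊗ proj (b τ̄⁻¹)`, which is the coordinate of index `(σ, τ)` on
`A ⊗ A^op` as a right module over `R ⊗ R^op`, with respect to the elements `σ̄ ⊗ τ̄`. -/
noncomputable def envProj (σ τ : G) : Env (CrossedProduct α) →ₗ[ℂ] Env R :=
  TensorProduct.map
    ((proj α).comp (LinearMap.mulLeft ℂ (((bar α σ)⁻¹ : (CrossedProduct α)ˣ) : CrossedProduct α)))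
    ((MulOpposite.opLinearEquiv ℂ).toLinearMap.comp <|
      ((proj α).comp (LinearMap.mulRight ℂ
        (((bar α τ)⁻¹ : (CrossedProduct α)ˣ) : CrossedProduct α))).comp
      (MulOpposite.opLinearEquiv ℂ).symm.toLinearMap)

theorem envProj_tmul (σ τ : G) (a : CrossedProduct α) (b : (CrossedProduct α)ᵐᵒᵖ) :
    envProj α σ τ (a ⊗ₜ b) =
      proj α (((bar α σ)⁻¹ : (CrossedProduct α)ˣ) * a) ⊗ₜ
        MulOpposite.op (proj α (b.unop * ((bar α τ)⁻¹ : (CrossedProduct α)ˣ))) :=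
  rfl

theorem envProj_mul_envMap (σ τ : G) (a : Env (CrossedProduct α)) (s : Env R) :
    envProj α σ τ (a * envMap (incl α) s) = envProj α σ τ a * s := by
  induction a using TensorProduct.induction_on with
  | zero => simp
  | add a b ha hb => simp [add_mul, ha, hb]
  | tmul a b =>
    induction s using TensorProduct.induction_on with
    | zero => simp
    | add s t hs ht => simp [mul_add, hs, ht]
    | tmul s t =>
      rw [Algebra.TensorProduct.map_tmul, Algebra.TensorProduct.tmul_mul_tmul, envProj_tmul,
        envProj_tmul, Algebra.TensorProduct.tmul_mul_tmul]
      refine congrArg₂ (· ⊗ₜ[ℂ] ·) ?_ (congrArg MulOpposite.op ?_)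
      · exact (congrArg (proj α) (mul_assoc _ a (incl α s)).symm).trans (proj_mul_incl α _ s)
      · exact (congrArg (proj α) (mul_assoc (incl α t.unop) b.unop _)).trans
          (proj_incl_mul α t.unop _)

theorem sum_mul_envProj [Fintype G] (a : Env (CrossedProduct α)) :
    ∑ i : G × G, ((bar α i.1 : CrossedProduct α) ⊗ₜ MulOpposite.op (bar α i.2 : CrossedProduct α) :
      Env (CrossedProduct α)) * envMap (incl α) (envProj α i.1 i.2 a) = a := by
  induction a using TensorProduct.induction_on with
  | zero => simp
  | add a b ha hb => simp [mul_add, Finset.sum_add_distrib, ha, hb]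
  | tmul a b =>
    conv_rhs => rw [← sum_bar_mul_proj α a, ← MulOpposite.op_unop b,
      ← sum_proj_mul_bar α b.unop, Finset.op_sum]
    rw [TensorProduct.sum_tmul, Fintype.sum_prod_type]
    refine Finset.sum_congr rfl fun σ _ => ?_
    rw [TensorProduct.tmul_sum]
    refine Finset.sum_congr rfl fun τ _ => ?_
    rw [envProj_tmul, Algebra.TensorProduct.map_tmul, Algebra.TensorProduct.tmul_mul_tmul]
    rfl

/-- Every `A`-bimodule embeds into an injective one that stays injective as an `R`-bimodule: the
coinduced module `Hom_ℂ(A ⊗ A^op, M)` is both. -/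
theorem exists_mono_injective [Finite G] (M : ModuleCat.{u} (Env (CrossedProduct α))) :
    ∃ (I : ModuleCat.{u} (Env (CrossedProduct α))) (f : M ⟶ I), Mono f ∧ Injective I ∧
      Injective ((restrict (incl α)).obj I) := by
  have := Fintype.ofFinite G
  exact ⟨_, (ModuleCat.restrictCoextendScalarsAdj
      (algebraMap ℂ (Env (CrossedProduct α)))).unit.app M, inferInstance,
    injective_coextendScalars_complex _,
    injective_restrictScalars_coextendScalars (envMap (incl α)) _ (fun i : G × G => envProj α i.1 i.2)
      (fun i => envProj_mul_envMap α i.1 i.2) (sum_mul_envProj α) _⟩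
end CrossedProduct

/-! ### The action of `G` and the restriction map for general coefficients -/

namespace CategoryTheory.Abelian.Ext

/-- If `F(e)` followed by `s` equals `t` followed by `e'`, then the operation that takes a class `x`
to `F(x)`, preceded by `r` and followed by `t` or `s`, carries composition with `e` to composition
with `e'`. For classes `e`, `e'` of short exact sequences, it commutes with connecting maps. -/
theorem mk₀_comp_mapExactFunctor_comp_mk₀ {C D : Type*} [Category* C] [Abelian C]
    [HasExt.{u} C] [Category* D] [Abelian D] [HasExt.{u} D] (F : C ⥤ D) [F.Additive]
    [Limits.PreservesFiniteLimits F] [Limits.PreservesFiniteColimits F] {W Y' Z' : D} {X Y Z : C}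
    (r : W ⟶ F.obj X) {s : F.obj Z ⟶ Z'} {t : F.obj Y ⟶ Y'} {m : ℕ} {e : Ext.{u} Y Z m}
    {e' : Ext.{u} Y' Z' m}
    (h : (e.mapExactFunctor F).comp (mk₀ s) (add_zero m) = (mk₀ t).comp e' (zero_add m))
    {n : ℕ} (x : Ext.{u} X Y n) :
    ((mk₀ r).comp ((x.comp e rfl).mapExactFunctor F) (zero_add (n + m))).comp
        (mk₀ s) (add_zero (n + m)) =
      (((mk₀ r).comp (x.mapExactFunctor F) (zero_add n)).comp (mk₀ t) (add_zero n)).comp e' rfl := by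
  rw [mapExactFunctor_comp, comp_assoc_of_third_deg_zero, comp_assoc_of_third_deg_zero, h,
    comp_assoc_of_second_deg_zero, ← comp_assoc_of_second_deg_zero,
    comp_assoc_of_second_deg_zero, comp_assoc]
  lia

end CategoryTheory.Abelian.Ext

namespace CrossedProduct

open Hochschild Abelian

variable {G R : Type u} [Group G] [Ring R] [Algebra ℂ R] [MulSemiringAction G R]
  [SMulCommClass G ℂ R] (α : CentralTwoCocycle G R)

/-- The element `σ̄ ⊗ σ̄⁻¹` of `A ⊗ A^op`. It acts on the bimodule `A` as `a ↦ σ̄ a σ̄⁻¹`, and on every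
`A`-bimodule by the analogous formula. -/
noncomputable def envBar (σ : G) : Env (CrossedProduct α) :=
  (bar α σ : CrossedProduct α) ⊗ₜ
    MulOpposite.op (((bar α σ)⁻¹ : (CrossedProduct α)ˣ) : CrossedProduct α)

theorem bar_mul_incl_inv_smul (σ : G) (p : R) :
    (bar α σ : CrossedProduct α) * incl α (σ⁻¹ • p) = incl α p * (bar α σ : CrossedProduct α) := by
  rw [bar_mul_incl, smul_inv_smul]

theorem incl_inv_smul_mul_inv_bar (σ : G) (p : R) :
    incl α (σ⁻¹ • p) * (((bar α σ)⁻¹ : (CrossedProduct α)ˣ) : CrossedProduct α) =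
      (((bar α σ)⁻¹ : (CrossedProduct α)ˣ) : CrossedProduct α) * incl α p := by
  rw [Units.mul_inv_eq_iff_eq_mul, mul_assoc, ← bar_mul_incl_inv_smul, Units.inv_mul_cancel_left]

theorem envBar_mul_envMap (σ : G) (t : Env R) :
    envBar α σ * envMap (incl α) (envMap (invAut R σ) t) = envMap (incl α) t * envBar α σ := by
  induction t using TensorProduct.induction_on with
  | zero => simp
  | add s t hs ht => simp only [map_add, mul_add, add_mul, hs, ht]
  | tmul p q =>
    simp only [Algebra.TensorProduct.map_tmul, envBar, Algebra.TensorProduct.tmul_mul_tmul]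
    exact congrArg₂ (· ⊗ₜ[ℂ] ·) (bar_mul_incl_inv_smul α σ p)
      (congrArg MulOpposite.op (incl_inv_smul_mul_inv_bar α σ q.unop))

/-- The elements `σ̄ ⊗ σ̄⁻¹` are multiplicative in `σ` only up to the elements `z ⊗ z⁻¹` with `z` a
value of the cocycle. -/
theorem envBar_mul_envBar (σ τ : G) :
    envBar α σ * envBar α τ = envMap (incl α)
      ((α σ τ : R) ⊗ₜ MulOpposite.op (((α σ τ)⁻¹ : Rˣ) : R)) * envBar α (σ * τ) := by
  have h : bar α σ * bar α τ = Units.map (incl α : R →* CrossedProduct α) (α σ τ) *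
      bar α (σ * τ) := Units.ext (bar_mul_bar α σ τ)
  simp only [Algebra.TensorProduct.map_tmul, envBar, Algebra.TensorProduct.tmul_mul_tmul]
  refine congrArg₂ (· ⊗ₜ[ℂ] ·) (bar_mul_bar α σ τ) (congrArg MulOpposite.op ?_)
  change (((bar α τ)⁻¹ * (bar α σ)⁻¹ : (CrossedProduct α)ˣ) : CrossedProduct α) = _
  rw [← mul_inv_rev, h, mul_inv_rev]
  rfl

theorem envBar_one :
    envBar α 1 = envMap (incl α) ((α 1 1 : R) ⊗ₜ MulOpposite.op (((α 1 1)⁻¹ : Rˣ) : R)) := by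
  have h : Units.map (incl α : R →* CrossedProduct α) (α 1 1) = bar α 1 := by
    ext
    change single α 1 _ = single α 1 1
    rw [Units.mul_inv]
  rw [envBar, ← h]
  rfl

/-- The map `m ↦ σ̄ m σ̄⁻¹` on `A`-bimodules `M`, as a natural morphism of `R`-bimodules from `M`
twisted by the automorphism `p ↦ σ⁻¹ · p` of `R` to `M`. -/
noncomputable def twist (σ : G) :
    restrict (incl α) ⋙ restrict (invAut R σ) ⟶ restrict (incl α) where
  app M := ModuleCat.ofHom (X := (restrict (invAut R σ)).obj ((restrict (incl α)).obj M))
    (Y := (restrict (incl α)).obj M)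
    { toFun m := envBar α σ • (show M from m)
      map_add' x y := smul_add _ (show M from x) (show M from y)
      map_smul' t m := (smul_smul (envBar α σ) _ (show M from m)).trans <|
        (congrArg (· • (show M from m)) (envBar_mul_envMap α σ t)).trans
          (mul_smul (envMap (incl α) t) (envBar α σ) (show M from m)) }
  naturality M N f := by
    ext m
    exact (map_smul f.hom (envBar α σ) (show M from m)).symm

theorem twist_app_regular (σ : G) :
    (twist α σ).app (regular (CrossedProduct α)) = conjBar α σ := by
  ext x
  exact regular_smul (bar α σ : CrossedProduct α) _ x

/-- The action of `σ ∈ G` on `HH^n(R, M)` for an `A`-bimodule `M`, by transport of structure along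
`p ↦ σ · p` on `R` and `m ↦ σ̄ m σ̄⁻¹` on `M`; for `M = A` this is `conjHH`. -/
noncomputable def conjExt (σ : G) (M : ModuleCat.{u} (Env (CrossedProduct α))) (n : ℕ) :
    HH R ((restrict (incl α)).obj M) n →ₗ[ℂ] HH R ((restrict (incl α)).obj M) n :=
  Ext.postcompOfLinear (Ext.mk₀ ((twist α σ).app M)) ℂ (regular R) (add_zero n) ∘ₗ
    Ext.precompOfLinear (Ext.mk₀ (regularMap (invAut R σ))) ℂ
      ((restrict (incl α) ⋙ restrict (invAut R σ)).obj M) (zero_add n) ∘ₗ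
      (restrict (invAut R σ)).mapExtLinearMap ℂ (regular R) ((restrict (incl α)).obj M) n

theorem conjExt_apply (σ : G) (M : ModuleCat.{u} (Env (CrossedProduct α))) (n : ℕ)
    (x : HH R ((restrict (incl α)).obj M) n) :
    conjExt α σ M n x = ((Ext.mk₀ (regularMap (invAut R σ))).comp
      (x.mapExactFunctor (restrict (invAut R σ))) (zero_add n)).comp
        (Ext.mk₀ ((twist α σ).app M)) (add_zero n) :=
  rfl

theorem conjExt_regular (σ : G) (n : ℕ) (x : HH R (coeff α) n) :
    conjExt α σ (regular (CrossedProduct α)) n x = conjHH α σ n x := by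
  refine (conjExt_apply α σ (regular (CrossedProduct α)) n x).trans ?_
  rw [twist_app_regular]
  rfl

/-- The restriction map `HH^n(A, M) → HH^n(R, M)` for an `A`-bimodule `M`; for `M = A` this is
`resHH`. -/
noncomputable def resExt (M : ModuleCat.{u} (Env (CrossedProduct α))) (n : ℕ) :
    HH (CrossedProduct α) M n →ₗ[ℂ] HH R ((restrict (incl α)).obj M) n :=
  Ext.precompOfLinear (Ext.mk₀ (regularMap (incl α))) ℂ ((restrict (incl α)).obj M) (zero_add n) ∘ₗ
    (restrict (incl α)).mapExtLinearMap ℂ (regular (CrossedProduct α)) M n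

theorem resExt_apply (M : ModuleCat.{u} (Env (CrossedProduct α))) (n : ℕ)
    (x : HH (CrossedProduct α) M n) :
    resExt α M n x = (Ext.mk₀ (regularMap (incl α))).comp
      (x.mapExactFunctor (restrict (incl α))) (zero_add n) :=
  rfl

theorem conjExt_comp_mk₀ (σ : G) {M N : ModuleCat.{u} (Env (CrossedProduct α))} (f : M ⟶ N) (n : ℕ)
    (x : HH R ((restrict (incl α)).obj M) n) :
    conjExt α σ N n (x.comp (Ext.mk₀ ((restrict (incl α)).map f)) (add_zero n)) =
      (conjExt α σ M n x).comp (Ext.mk₀ ((restrict (incl α)).map f)) (add_zero n) := by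
  have h : (restrict (invAut R σ)).map ((restrict (incl α)).map f) ≫ (twist α σ).app N =
      (twist α σ).app M ≫ (restrict (incl α)).map f := (twist α σ).naturality f
  simp only [conjExt_apply, Ext.mapExactFunctor_comp, Ext.mapExactFunctor_mk₀]
  simp only [Ext.comp_assoc_of_third_deg_zero, Ext.mk₀_comp_mk₀]
  rw [← h]

theorem conjExt_comp_extClass (σ : G) {S : ShortComplex (ModuleCat.{u} (Env (CrossedProduct α)))}
    (hS : S.ShortExact) (n : ℕ) (x : HH R ((restrict (incl α)).obj S.X₃) n) :
    conjExt α σ S.X₁ (n + 1) (x.comp (hS.map_of_exact (restrict (incl α))).extClass rfl) =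
      (conjExt α σ S.X₃ n x).comp (hS.map_of_exact (restrict (incl α))).extClass rfl := by
  have h := ShortComplex.ShortExact.extClass_naturality
    ((hS.map_of_exact (restrict (incl α))).map_of_exact (restrict (invAut R σ)))
    (hS.map_of_exact (restrict (incl α))) (S.mapNatTrans (twist α σ))
  rw [← Ext.mapExactFunctor_extClass] at h
  exact Ext.mk₀_comp_mapExactFunctor_comp_mk₀ (restrict (invAut R σ)) _ h x

theorem resExt_comp_mk₀ {M N : ModuleCat.{u} (Env (CrossedProduct α))} (f : M ⟶ N) (n : ℕ)
    (x : HH (CrossedProduct α) M n) :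
    resExt α N n (x.comp (Ext.mk₀ f) (add_zero n)) =
      (resExt α M n x).comp (Ext.mk₀ ((restrict (incl α)).map f)) (add_zero n) := by
  simp only [resExt_apply, Ext.mapExactFunctor_comp, Ext.mapExactFunctor_mk₀]
  simp only [Ext.comp_assoc_of_third_deg_zero]

theorem resExt_comp_extClass {S : ShortComplex (ModuleCat.{u} (Env (CrossedProduct α)))}
    (hS : S.ShortExact) (n : ℕ) (x : HH (CrossedProduct α) S.X₃ n) :
    resExt α S.X₁ (n + 1) (x.comp hS.extClass rfl) =
      (resExt α S.X₃ n x).comp (hS.map_of_exact (restrict (incl α))).extClass rfl := by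
  rw [← Ext.mapExactFunctor_extClass]
  refine (congrArg (fun y => (Ext.mk₀ (regularMap (incl α))).comp y (zero_add (n + 1)))
    (Ext.mapExactFunctor_comp (restrict (incl α)) x hS.extClass rfl)).trans ?_
  exact (Ext.comp_assoc _ _ _ (zero_add n) _ (by lia)).symm

end CrossedProduct

/-! ### Degree zero -/

namespace Hochschild

variable {B C : Type u} [Ring B] [Algebra ℂ B] [Ring C] [Algebra ℂ C]

/-- The value at `b` of a morphism of bimodules from `B`. -/
noncomputable def evalAt {M : ModuleCat.{u} (Env B)} (f : regular B ⟶ M) (b : B) : M :=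
  f.hom (show regular B from b)

theorem evalAt_mul_mul {M : ModuleCat.{u} (Env B)} (f : regular B ⟶ M) (a b c : B) :
    evalAt f (a * b * c) = (a ⊗ₜ MulOpposite.op c : Env B) • evalAt f b :=
  (congrArg f.hom (regular_smul a (MulOpposite.op c) b).symm).trans (map_smul f.hom _ _)

theorem hom_ext_evalAt {M : ModuleCat.{u} (Env B)} {f g : regular B ⟶ M}
    (h : ∀ b, evalAt f b = evalAt g b) : f = g := by
  ext b
  exact h b

/-- The value at `b` of a morphism of `B`-bimodules from `B` to a `C`-bimodule `M` restricted along
`φ : B → C`, as an element of the `C`-bimodule `M`. -/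
noncomputable def evalAlong (φ : B →ₐ[ℂ] C) {M : ModuleCat.{u} (Env C)}
    (f : regular B ⟶ (restrict φ).obj M) (b : B) : M :=
  show (restrict φ).obj M from evalAt f b

theorem evalAlong_mul_mul (φ : B →ₐ[ℂ] C) {M : ModuleCat.{u} (Env C)}
    (f : regular B ⟶ (restrict φ).obj M) (a b c : B) :
    evalAlong φ f (a * b * c) = envMap φ (a ⊗ₜ MulOpposite.op c) • evalAlong φ f b :=
  evalAt_mul_mul f a b c

theorem hom_ext_evalAlong (φ : B →ₐ[ℂ] C) {M : ModuleCat.{u} (Env C)}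
    {f g : regular B ⟶ (restrict φ).obj M} (h : ∀ b, evalAlong φ f b = evalAlong φ g b) : f = g :=
  hom_ext_evalAt h

theorem evalAlong_regularMap_comp (φ : B →ₐ[ℂ] C) {M : ModuleCat.{u} (Env C)}
    (f : regular C ⟶ M) (b : B) :
    evalAlong φ (regularMap φ ≫ (restrict φ).map f) b = evalAt f (φ b) :=
  rfl

end Hochschild

namespace CrossedProduct

open Hochschild Abelian

variable {G R : Type u} [Group G] [Ring R] [Algebra ℂ R] [MulSemiringAction G R]
  [SMulCommClass G ℂ R] (α : CentralTwoCocycle G R)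

theorem conjExt_mk₀ (σ : G) (M : ModuleCat.{u} (Env (CrossedProduct α)))
    (f : regular R ⟶ (restrict (incl α)).obj M) :
    conjExt α σ M 0 (Ext.mk₀ f) = Ext.mk₀ (regularMap (invAut R σ) ≫
      (restrict (invAut R σ)).map f ≫ (twist α σ).app M) := by
  rw [conjExt_apply, Ext.mapExactFunctor_mk₀, Ext.mk₀_comp_mk₀, Ext.mk₀_comp_mk₀, Category.assoc]

theorem resExt_mk₀ (M : ModuleCat.{u} (Env (CrossedProduct α)))
    (f : regular (CrossedProduct α) ⟶ M) :
    resExt α M 0 (Ext.mk₀ f) = Ext.mk₀ (regularMap (incl α) ≫ (restrict (incl α)).map f) := by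
  rw [resExt_apply, Ext.mapExactFunctor_mk₀, Ext.mk₀_comp_mk₀]

theorem evalAlong_conj (σ : G) (M : ModuleCat.{u} (Env (CrossedProduct α)))
    (f : regular R ⟶ (restrict (incl α)).obj M) (r : R) :
    evalAlong (incl α)
      (regularMap (invAut R σ) ≫ (restrict (invAut R σ)).map f ≫ (twist α σ).app M) r =
      envBar α σ • evalAlong (incl α) f (σ⁻¹ • r) :=
  rfl

/-- Conjugation by a central unit `z` of `R` fixes the image of any morphism of `R`-bimodules
`f : R → M`, because `z f(r) z⁻¹ = f(z r z⁻¹) = f(r)`. -/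
theorem envMap_unit_smul_evalAlong (M : ModuleCat.{u} (Env (CrossedProduct α)))
    (f : regular R ⟶ (restrict (incl α)).obj M) (z : Rˣ) (hz : ∀ r : R, r * z = z * r) (r : R) :
    envMap (incl α) ((z : R) ⊗ₜ MulOpposite.op ((z⁻¹ : Rˣ) : R)) • evalAlong (incl α) f r =
      evalAlong (incl α) f r := by
  rw [← evalAlong_mul_mul, ← hz, mul_assoc, Units.mul_inv, mul_one]

theorem conjExt_zero_conjExt (σ τ : G) (M : ModuleCat.{u} (Env (CrossedProduct α)))
    (x : HH R ((restrict (incl α)).obj M) 0) :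
    conjExt α σ M 0 (conjExt α τ M 0 x) = conjExt α (σ * τ) M 0 x := by
  obtain ⟨f, rfl⟩ := (Ext.mk₀_bijective _ _).2 x
  simp only [conjExt_mk₀]
  refine congrArg Ext.mk₀ (hom_ext_evalAlong (incl α) fun r => ?_)
  rw [evalAlong_conj, evalAlong_conj, evalAlong_conj, smul_smul, smul_smul, envBar_mul_envBar,
    ← mul_inv_rev, mul_smul, ← evalAlong_conj, envMap_unit_smul_evalAlong _ _ _ _ (α.comm σ τ)]

theorem conjExt_zero_one (M : ModuleCat.{u} (Env (CrossedProduct α)))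
    (x : HH R ((restrict (incl α)).obj M) 0) : conjExt α 1 M 0 x = x := by
  obtain ⟨f, rfl⟩ := (Ext.mk₀_bijective _ _).2 x
  rw [conjExt_mk₀]
  refine congrArg Ext.mk₀ (hom_ext_evalAlong (incl α) fun r => ?_)
  rw [evalAlong_conj, inv_one, one_smul, envBar_one,
    envMap_unit_smul_evalAlong _ _ _ _ (α.comm 1 1)]

theorem conjExt_zero_resExt (σ : G) (M : ModuleCat.{u} (Env (CrossedProduct α)))
    (x : HH (CrossedProduct α) M 0) : conjExt α σ M 0 (resExt α M 0 x) = resExt α M 0 x := by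
  obtain ⟨f, rfl⟩ := (Ext.mk₀_bijective _ _).2 x
  rw [resExt_mk₀, conjExt_mk₀]
  refine congrArg Ext.mk₀ (hom_ext_evalAlong (incl α) fun r => ?_)
  rw [evalAlong_conj, evalAlong_regularMap_comp, evalAlong_regularMap_comp, envBar, ← evalAt_mul_mul,
    bar_mul_incl_inv_smul, mul_assoc, Units.mul_inv, mul_one]

theorem resExt_zero_injective (M : ModuleCat.{u} (Env (CrossedProduct α))) :
    Function.Injective (resExt α M 0) := by
  intro x y h
  obtain ⟨f, rfl⟩ := (Ext.mk₀_bijective _ _).2 x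
  obtain ⟨g, rfl⟩ := (Ext.mk₀_bijective _ _).2 y
  rw [resExt_mk₀, resExt_mk₀] at h
  refine congrArg Ext.mk₀ (hom_ext_evalAt fun a => ?_)
  have h1 := congrArg (fun f => evalAlong (incl α) f 1) ((Ext.mk₀_bijective _ _).1 h)
  simp only [evalAlong_regularMap_comp, map_one] at h1
  have ha : a = a * 1 * 1 := by simp
  rw [ha, evalAt_mul_mul, h1, ← evalAt_mul_mul]

/-- In degree zero, an invariant class is an element `m = g(1)` of `M` that commutes with `R` and
with all `σ̄`, hence with all of `A`, so `a ↦ a m` is a morphism of `A`-bimodules. -/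
theorem exists_resExt_zero_eq (M : ModuleCat.{u} (Env (CrossedProduct α)))
    (x : HH R ((restrict (incl α)).obj M) 0) (hx : ∀ σ, conjExt α σ M 0 x = x) :
    ∃ y, resExt α M 0 y = x := by
  obtain ⟨g, rfl⟩ := (Ext.mk₀_bijective _ _).2 x
  let m : M := evalAlong (incl α) g 1
  have hg (r : R) : evalAlong (incl α) g r = (incl α r ⊗ₜ 1 : Env (CrossedProduct α)) • m := by
    have h := evalAlong_mul_mul (incl α) g r 1 1
    rwa [mul_one, mul_one, MulOpposite.op_one, Algebra.TensorProduct.map_tmul, map_one] at h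
  have hg' (r : R) : evalAlong (incl α) g r =
      (1 ⊗ₜ MulOpposite.op (incl α r) : Env (CrossedProduct α)) • m := by
    have h := evalAlong_mul_mul (incl α) g 1 1 r
    rwa [one_mul, one_mul, Algebra.TensorProduct.map_tmul, map_one] at h
  have hbar (σ : G) : envBar α σ • m = m := by
    have h := hx σ
    rw [conjExt_mk₀] at h
    have h1 := congrArg (fun f => evalAlong (incl α) f 1) ((Ext.mk₀_bijective _ _).1 h)
    simp only [evalAlong_conj, smul_one] at h1
    exact h1
  -- `m` commutes with every `a = p σ̄` since it commutes with `p` and with `σ̄`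
  have hcomm (a : CrossedProduct α) : (1 ⊗ₜ MulOpposite.op a : Env (CrossedProduct α)) • m =
      (a ⊗ₜ 1 : Env (CrossedProduct α)) • m := by
    induction a using induction_single with
    | zero => simp
    | add a b ha hb =>
      rw [MulOpposite.op_add, TensorProduct.tmul_add, add_smul, ha, hb, TensorProduct.add_tmul,
        add_smul]
    | single σ p =>
      have hσ : (1 ⊗ₜ MulOpposite.op (bar α σ : CrossedProduct α) : Env (CrossedProduct α)) • m =
          ((bar α σ : CrossedProduct α) ⊗ₜ 1 : Env (CrossedProduct α)) • m := by
        conv_lhs => rw [← hbar σ]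
        rw [smul_smul, envBar, Algebra.TensorProduct.tmul_mul_tmul, one_mul, ← MulOpposite.op_mul,
          Units.inv_mul, MulOpposite.op_one]
      have e1 : (1 ⊗ₜ MulOpposite.op (single α σ p) : Env (CrossedProduct α)) =
          (1 ⊗ₜ MulOpposite.op (bar α σ : CrossedProduct α)) * (1 ⊗ₜ MulOpposite.op (incl α p)) := by
        rw [single_eq_incl_mul_bar, Algebra.TensorProduct.tmul_mul_tmul, one_mul, MulOpposite.op_mul]
      have e2 : (1 ⊗ₜ MulOpposite.op (bar α σ : CrossedProduct α)) * (incl α p ⊗ₜ 1) =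
          ((incl α p ⊗ₜ 1) * (1 ⊗ₜ MulOpposite.op (bar α σ : CrossedProduct α)) :
            Env (CrossedProduct α)) := by
        simp only [Algebra.TensorProduct.tmul_mul_tmul, one_mul, mul_one]
      rw [e1, mul_smul, ← hg', hg, smul_smul, e2, mul_smul, hσ, smul_smul,
        Algebra.TensorProduct.tmul_mul_tmul, mul_one, single_eq_incl_mul_bar]
  let f : regular (CrossedProduct α) ⟶ M := homMk (M := regular (CrossedProduct α)) (N := M)
    { toFun a := ((show CrossedProduct α from a) ⊗ₜ 1 : Env (CrossedProduct α)) • m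
      map_zero' := by
        rw [← zero_smul (Env (CrossedProduct α)) m]
        exact congrArg (· • m) (TensorProduct.zero_tmul _ _)
      map_add' a b := by
        rw [← add_smul]
        exact congrArg (· • m) (TensorProduct.add_tmul (show CrossedProduct α from a)
          (show CrossedProduct α from b) _) }
    fun b b' a => by
      refine Eq.trans (b := ((b * (show CrossedProduct α from a) * b'.unop) ⊗ₜ 1 :
        Env (CrossedProduct α)) • m) ?_ ?_
      · exact congrArg (fun t : CrossedProduct α => (t ⊗ₜ 1 : Env (CrossedProduct α)) • m)
          (regular_smul b b' (show CrossedProduct α from a))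
      · change _ = (b ⊗ₜ b' : Env (CrossedProduct α)) •
          (((show CrossedProduct α from a) ⊗ₜ 1 : Env (CrossedProduct α)) • m)
        rw [smul_smul, Algebra.TensorProduct.tmul_mul_tmul, mul_one]
        have e1 (c : CrossedProduct α) : c ⊗ₜ b' = (c ⊗ₜ 1 * 1 ⊗ₜ MulOpposite.op b'.unop :
            Env (CrossedProduct α)) := by
          rw [Algebra.TensorProduct.tmul_mul_tmul, one_mul, mul_one, MulOpposite.op_unop]
        rw [e1, mul_smul, hcomm, smul_smul, Algebra.TensorProduct.tmul_mul_tmul, mul_one]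
  refine ⟨Ext.mk₀ f, ?_⟩
  rw [resExt_mk₀]
  refine congrArg Ext.mk₀ (hom_ext_evalAlong (incl α) fun r => ?_)
  rw [evalAlong_regularMap_comp, hg]
  rfl

end CrossedProduct

/-! ### Dimension shifting -/

namespace Representation

/-- If the order of `G` is invertible, the averaging operator lifts invariant elements in the image
of an equivariant map to invariant elements: taking invariants is exact. -/
theorem exists_mem_invariants_of_map_mem_invariants {k G V W : Type*} [CommRing k] [Group G]
    [Fintype G] [Invertible (Fintype.card G : k)] [AddCommGroup V] [Module k V] [AddCommGroup W]
    [Module k W] (ρ : Representation k G V) (τ : Representation k G W) (φ : V →ₗ[k] W)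
    (hφ : ∀ g v, φ (ρ g v) = τ g (φ v)) (v : V) (hv : φ v ∈ τ.invariants) :
    ∃ v' ∈ ρ.invariants, φ v' = φ v := by
  refine ⟨ρ.averageMap v, ρ.averageMap_invariant v, ?_⟩
  rw [← τ.averageMap_id (φ v) hv]
  simp [averageMap, GroupAlgebra.average, hφ]

end Representation

namespace CrossedProduct

open Hochschild Abelian

variable {G R : Type u} [Group G] [Ring R] [Algebra ℂ R] [MulSemiringAction G R]
  [SMulCommClass G ℂ R] (α : CentralTwoCocycle G R)

theorem exists_shortExact [Finite G] (M : ModuleCat.{u} (Env (CrossedProduct α))) :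
    ∃ S : ShortComplex (ModuleCat.{u} (Env (CrossedProduct α))), S.ShortExact ∧ S.X₁ = M ∧
      Injective S.X₂ ∧ Injective ((restrict (incl α)).obj S.X₂) := by
  obtain ⟨I, f, hf, hI, hI'⟩ := exists_mono_injective α M
  exact ⟨ShortComplex.mk _ _ (Limits.cokernel.condition f),
    { exact := ShortComplex.exact_cokernel f }, rfl, hI, hI'⟩

variable {α} in
theorem exists_comp_extClass_eq {S : ShortComplex (ModuleCat.{u} (Env (CrossedProduct α)))}
    (hS : S.ShortExact) (hI : Injective ((restrict (incl α)).obj S.X₂)) (n : ℕ)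
    (x : HH R ((restrict (incl α)).obj S.X₁) (n + 1)) :
    ∃ y : HH R ((restrict (incl α)).obj S.X₃) n,
      Ext.comp y (hS.map_of_exact (restrict (incl α))).extClass rfl = x :=
  Ext.covariant_sequence_exact₁ _ (hS.map_of_exact (restrict (incl α))) x
    (@Ext.eq_zero_of_injective _ _ _ _ _ _ _ hI _) rfl

variable [Finite G]

theorem conjExt_conjExt (σ τ : G) (M : ModuleCat.{u} (Env (CrossedProduct α))) (n : ℕ)
    (x : HH R ((restrict (incl α)).obj M) n) :
    conjExt α σ M n (conjExt α τ M n x) = conjExt α (σ * τ) M n x := by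
  induction n generalizing M with
  | zero => exact conjExt_zero_conjExt α σ τ M x
  | succ n ih =>
    obtain ⟨S, hS, rfl, -, hI⟩ := exists_shortExact α M
    obtain ⟨y, rfl⟩ := exists_comp_extClass_eq hS ‹_› n x
    rw [conjExt_comp_extClass _ _ hS, conjExt_comp_extClass _ _ hS, conjExt_comp_extClass _ _ hS, ih]

theorem conjExt_one (M : ModuleCat.{u} (Env (CrossedProduct α))) (n : ℕ)
    (x : HH R ((restrict (incl α)).obj M) n) : conjExt α 1 M n x = x := by
  induction n generalizing M with
  | zero => exact conjExt_zero_one α M x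
  | succ n ih =>
    obtain ⟨S, hS, rfl, -, hI⟩ := exists_shortExact α M
    obtain ⟨y, rfl⟩ := exists_comp_extClass_eq hS ‹_› n x
    rw [conjExt_comp_extClass _ _ hS, ih]

/-- The representation of `G` on `HH^n(R, M)` by the operators `conjExt`. -/
noncomputable def conjRep (M : ModuleCat.{u} (Env (CrossedProduct α))) (n : ℕ) :
    Representation ℂ G (HH R ((restrict (incl α)).obj M) n) where
  toFun σ := conjExt α σ M n
  map_one' := LinearMap.ext fun x => conjExt_one α M n x
  map_mul' σ τ := LinearMap.ext fun x => (conjExt_conjExt α σ τ M n x).symm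

theorem conjExt_resExt (σ : G) (M : ModuleCat.{u} (Env (CrossedProduct α))) (n : ℕ)
    (x : HH (CrossedProduct α) M n) : conjExt α σ M n (resExt α M n x) = resExt α M n x := by
  induction n generalizing M with
  | zero => exact conjExt_zero_resExt α σ M x
  | succ n ih =>
    obtain ⟨S, hS, rfl, hI, -⟩ := exists_shortExact α M
    obtain ⟨y, rfl⟩ := Ext.covariant_sequence_exact₁ _ hS x (Ext.eq_zero_of_injective _) rfl
    rw [resExt_comp_extClass _ hS, conjExt_comp_extClass _ _ hS, ih]

/-- The restriction map is an isomorphism onto the invariants, by dimension shifting along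
`0 → M → I → N → 0` with `I` injective for both algebras. The two long exact sequences present
`HH^{n+1}(-, M)` as the cokernel of `HH^n(-, I) → HH^n(-, N)`, a presentation that taking
`G`-invariants preserves. -/
theorem resExt_injective_and_exists (M : ModuleCat.{u} (Env (CrossedProduct α))) (n : ℕ) :
    Function.Injective (resExt α M n) ∧
      ∀ x, (∀ σ, conjExt α σ M n x = x) → ∃ y, resExt α M n y = x := by
  induction n generalizing M with
  | zero => exact ⟨resExt_zero_injective α M, exists_resExt_zero_eq α M⟩
  | succ n ih =>
    obtain ⟨S, hS, rfl, hI, hI'⟩ := exists_shortExact α M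
    have := Fintype.ofFinite G
    have := invertibleOfNonzero (Nat.cast_ne_zero.2 (Fintype.card_ne_zero (α := G)) :
      (Fintype.card G : ℂ) ≠ 0)
    have hS' := hS.map_of_exact (restrict (incl α))
    constructor
    · refine (injective_iff_map_eq_zero _).2 fun x hx => ?_
      obtain ⟨y, rfl⟩ := Ext.covariant_sequence_exact₁ _ hS x (Ext.eq_zero_of_injective _) rfl
      rw [resExt_comp_extClass] at hx
      obtain ⟨z, hz⟩ := Ext.covariant_sequence_exact₃ _ hS' _ rfl hx
      -- `res y` is invariant, so its preimage `z` in `HH^n(R, I)` can be averaged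
      obtain ⟨z', hz', hzz⟩ := Representation.exists_mem_invariants_of_map_mem_invariants
        (conjRep α S.X₂ n) (conjRep α S.X₃ n)
        (Ext.postcompOfLinear (Ext.mk₀ ((restrict (incl α)).map S.g)) ℂ (regular R) (add_zero n))
        (fun σ x => (conjExt_comp_mk₀ α σ S.g n x).symm) z (fun σ => by
          refine (congrArg (conjExt α σ S.X₃ n) hz).trans (Eq.trans ?_ hz.symm)
          exact conjExt_resExt α σ S.X₃ n y)
      obtain ⟨w, rfl⟩ := (ih S.X₂).2 z' hz'
      have h : w.comp (Ext.mk₀ S.g) (add_zero n) = y := by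
        refine (ih S.X₃).1 ?_
        rw [resExt_comp_mk₀]
        exact hzz.trans hz
      rw [← h, Ext.comp_assoc_of_second_deg_zero, hS.comp_extClass, Ext.comp_zero]
    · intro x hx
      obtain ⟨y, rfl⟩ := exists_comp_extClass_eq hS ‹_› n x
      -- `y` itself need not be invariant, but its image `x` is
      obtain ⟨z, hz, hzy⟩ := Representation.exists_mem_invariants_of_map_mem_invariants
        (conjRep α S.X₃ n) (conjRep α S.X₁ (n + 1))
        (Ext.postcompOfLinear hS'.extClass ℂ (regular R) rfl)
        (fun σ x => (conjExt_comp_extClass α σ hS n x).symm) y hx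
      obtain ⟨w, rfl⟩ := (ih S.X₃).2 z hz
      exact ⟨w.comp hS.extClass rfl, (resExt_comp_extClass α hS n w).trans hzy⟩

end CrossedProduct

theorem proposition4p1 {R G : Type u} [Ring R] [Algebra ℂ R] [Group G] [Finite G]
    [MulSemiringAction G R] [SMulCommClass G ℂ R] (α : CentralTwoCocycle G R) (n : ℕ) :
    ∃ ρ : Representation ℂ G (Hochschild.HH R (CrossedProduct.coeff α) n),
      (∀ (σ : G) (x : Hochschild.HH R (CrossedProduct.coeff α) n),
        ρ σ x = CrossedProduct.conjHH α σ n x) ∧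
      ∃ e : Hochschild.HH (CrossedProduct α) (Hochschild.regular (CrossedProduct α)) n
          ≃ₗ[ℂ] ρ.invariants,
        ∀ x, (e x : Hochschild.HH R (CrossedProduct.coeff α) n) = CrossedProduct.resHH α n x := by
  refine ⟨CrossedProduct.conjRep α (Hochschild.regular (CrossedProduct α)) n,
    fun σ => CrossedProduct.conjExt_regular α σ n, ?_⟩
  obtain ⟨hinj, hsurj⟩ :=
    CrossedProduct.resExt_injective_and_exists α (Hochschild.regular (CrossedProduct α)) n
  refine ⟨LinearEquiv.ofBijective
    ((CrossedProduct.resExt α (Hochschild.regular (CrossedProduct α)) n).codRestrict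
      (CrossedProduct.conjRep α (Hochschild.regular (CrossedProduct α)) n).invariants
      fun x σ => CrossedProduct.conjExt_resExt α σ _ n x)
    ⟨fun x y h => hinj (congrArg Subtype.val h), fun x => ?_⟩, fun x => rfl⟩
  obtain ⟨y, hy⟩ := hsurj x.1 x.2
  exact ⟨y, Subtype.ext hy⟩
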